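/- Let $(\Omega,\mu)$ be a $\sigma$-finite, non-atomic measure space. All functions are measurable scalar (real or complex) functions on $\Omega$, identified when equal $\mu$-a.e.; $f^*(t)=\inf\{s\ge 0:\mu\{|f|>s\}\le t\}$, $t>0$, is the non-increasing rearrangement of $f$, and $\|\cdot\|_{q,(c,d)}$ is the usual (quasi-)norm of $L_q$ on the interval $(c,d)$, with $1/\infty=0$ and $1/0=\infty$. Let $SV$ be the set of positive Lebesgue measurable functions $b$ on $(0,\infty)$ such that, for each $\varepsilon>0$, $t^{\varepsilon}b(t)$ is equivalent (up to positive constant factors) to a non-decreasing function and $t^{-\varepsilon}b(t)$ is equivalent to a non-increasing function. For two quasi-normed spaces $A_0,A_1$ of such functions, $0<\theta\le 1$, $0<q,r\le\infty$ and $a,b\in SV$, let $(A_0,A_1)^{\mathcal R}_{\theta,r,b,q,a}$ be the space of all $f\in A_0+A_1$ with $$\Big\|t^{-\frac1r}b(t)\,\big\|u^{-\theta-\frac1q}a(u)K(u,f)\big\|_{q,(t,\infty)}\Big\|_{r,(0,\infty)}<\infty,$$ $$K(u,f)=\inf\{\|f_0\|_{A_0}+u\|f_1\|_{A_1}: f=f_0+f_1,\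 f_i\in A_i\}.$$ For $0<p,q,r\le\infty$ and $a,b\in SV$, let $L^{\mathcal R}_{p,r,b,q,a}$ be the space of all $f$ with $$\Big\|t^{-\frac1r}b(t)\,\big\|u^{\frac1p-\frac1q}a(u)f^*(u)\big\|_{q,(t,\infty)}\Big\|_{r,(0,\infty)}<\infty,$$ and let the grand Lorentz–Karamata space $L^{p),q,r}_b$ be the space of all $f$ with $$\Big\|t^{-\frac1r}b(t)\,\big\|u^{\frac1p-\frac1q}f^*(u)\big\|_{q,(t,\infty)}\Big\|_{r,(0,\infty)}<\infty;$$ each of these spaces is quasi-normed by the displayed expression. Let $L_{\kappa,\infty}$ be the weak $L_\kappa$ space, quasi-normed by $\sup_{t>0}t^{1/\kappa}f^*(t)$. Equality of spaces means equality as sets with equivalent quasi-norms. **Theorem.** Let $0<\theta\le1$, $0<\kappa<\infty$, $p=\frac{\kappa}{1-\theta}$ (so $p=\infty$ if $\theta=1$), $0<q,r\le\infty$ and $a,b\in SV$. Put $\dddot a(t)=a(t^{1/\kappa})$ and $\dddot b(t)=b(t^{1/\kappa})$ for $t>0$. Then $$(L_\kappa,L_\infty)^{\mathcal R}_{\theta,r,b,q,a}=(L_{\kappa,\infty},L_\infty)^{\mathcal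 R}_{\theta,r,b,q,a}=L^{\mathcal R}_{p,r,\dddot b,q,\dddot a}.$$ In particular, for $a\equiv 1$, $$(L_\kappa,L_\infty)^{\mathcal R}_{\theta,r,b,q,1}=(L_{\kappa,\infty},L_\infty)^{\mathcal R}_{\theta,r,b,q,1}=L^{p),q,r}_{\dddot b}.$$ -/

import Mathlib

open MeasureTheory Set
open scoped ENNReal NNReal

/-- `μ` is non-atomic: every measurable set of positive measure has a measurable subset of
strictly smaller positive measure. -/
def IsNonatomicMeasure {Ω : Type*} [MeasurableSpace Ω] (μ : Measure Ω) : Prop :=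
  ∀ A : Set Ω, MeasurableSet A → 0 < μ A → ∃ B ⊆ A, MeasurableSet B ∧ 0 < μ B ∧ μ B < μ A

/-- `b ∈ SV`: `b` is positive and Lebesgue measurable on `(0, ∞)` and, for each `ε > 0`,
`t ^ ε * b t` is equivalent to a non-decreasing function and `t ^ (-ε) * b t` is equivalent to
a non-increasing function. Only the values of `b` on `(0, ∞)` matter. -/
structure IsSlowlyVarying (b : ℝ → ℝ) : Prop where
  pos : ∀ t : ℝ, 0 < t → 0 < b t
  aemeasurable : AEMeasurable b (volume.restrict (Ioi 0))
  equiv_increasing : ∀ ε : ℝ, 0 < ε → ∃ g : ℝ → ℝ, MonotoneOn g (Ioi 0) ∧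
    ∃ c C : ℝ, 0 < c ∧ 0 < C ∧ ∀ t : ℝ, 0 < t → c * g t ≤ t ^ ε * b t ∧ t ^ ε * b t ≤ C * g t
  equiv_decreasing : ∀ ε : ℝ, 0 < ε → ∃ g : ℝ → ℝ, AntitoneOn g (Ioi 0) ∧
    ∃ c C : ℝ, 0 < c ∧ 0 < C ∧
      ∀ t : ℝ, 0 < t → c * g t ≤ t ^ (-ε) * b t ∧ t ^ (-ε) * b t ≤ C * g t

/-- The weighted quasi-norm `‖ t ^ (σ - 1/q) a(t) φ(t) ‖_{q, s}` over a set `s` of positive reals,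
for a function `φ` with values in `[0, ∞]`, with the convention `1/∞ = 0`. -/
noncomputable def weightedNorm (σ : ℝ) (q : ℝ≥0∞) (a : ℝ → ℝ) (φ : ℝ → ℝ≥0∞) (s : Set ℝ) : ℝ≥0∞ :=
  eLpNorm (fun t : ℝ => ENNReal.ofReal (t ^ (σ - (1 / q).toReal) * a t) * φ t) q
    (volume.restrict s)

/-- The iterated quasi-norm
`‖ t ^ (-1/r) b(t) ‖ u ^ (σ - 1/q) a(u) φ(u) ‖_{q, (t, ∞)} ‖_{r, (0, ∞)}`. -/
noncomputable def rNorm (σ : ℝ) (r : ℝ≥0∞) (b : ℝ → ℝ) (q : ℝ≥0∞) (a : ℝ → ℝ)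
    (φ : ℝ → ℝ≥0∞) : ℝ≥0∞ :=
  weightedNorm 0 r b (fun t : ℝ => weightedNorm σ q a φ (Ioi t)) (Ioi 0)

section FunctionSpaces

variable {Ω : Type*} [MeasurableSpace Ω]

/-- A space of (classes of) measurable functions on `Ω` together with the functional that serves
as its quasi-norm. -/
structure FunctionSpace (μ : Measure Ω) (𝕜 : Type*) [RCLike 𝕜] where
  carrier : Set (Ω →ₘ[μ] 𝕜)
  qnorm : (Ω →ₘ[μ] 𝕜) → ℝ≥0∞

variable {μ : Measure Ω} {𝕜 : Type*} [RCLike 𝕜]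

/-- The space of all measurable `f` with `N f < ∞`, quasi-normed by `N`. -/
def FunctionSpace.ofQNorm (N : (Ω →ₘ[μ] 𝕜) → ℝ≥0∞) : FunctionSpace μ 𝕜 where
  carrier := {f | N f < ∞}
  qnorm := N

/-- Continuous embedding: `X ⊆ Y` and `‖f‖_Y ≤ C ‖f‖_X` for all `f ∈ X`. -/
def FunctionSpace.Embeds (X Y : FunctionSpace μ 𝕜) : Prop :=
  X.carrier ⊆ Y.carrier ∧ ∃ C : ℝ≥0, ∀ f ∈ X.carrier, Y.qnorm f ≤ C * X.qnorm f

/-- Equality of quasi-normed spaces: the same elements, with equivalent quasi-norms. -/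
def FunctionSpace.Equal (X Y : FunctionSpace μ 𝕜) : Prop :=
  X.Embeds Y ∧ Y.Embeds X

/-- The non-increasing rearrangement `f^*(t) = inf {s ≥ 0 : μ {|f| > s} ≤ t}`, `t > 0`. -/
noncomputable def rearrangement (f : Ω →ₘ[μ] 𝕜) (t : ℝ) : ℝ≥0∞ :=
  sInf {s : ℝ≥0∞ | μ {x | s < ‖f x‖ₑ} ≤ ENNReal.ofReal t}

variable (μ 𝕜)

/-- The Lebesgue space `L_p`, `0 < p ≤ ∞`. -/
noncomputable def lebesgueSpace (p : ℝ≥0∞) : FunctionSpace μ 𝕜 :=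
  .ofQNorm fun f => eLpNorm f p μ

/-- The Lorentz-Karamata space `L_{p,q;a}`, with quasi-norm
`‖ t ^ (1/p - 1/q) a(t) f^*(t) ‖_{q, (0, ∞)}`. -/
noncomputable def lorentzKaramataSpace (p q : ℝ≥0∞) (a : ℝ → ℝ) : FunctionSpace μ 𝕜 :=
  .ofQNorm fun f => weightedNorm (1 / p).toReal q a (rearrangement f) (Ioi 0)

/-- The Lorentz space `L_{p,q}`; for `q = ∞` it is weak `L_p`. -/
noncomputable def lorentzSpace (p q : ℝ≥0∞) : FunctionSpace μ 𝕜 :=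
  lorentzKaramataSpace μ 𝕜 p q fun _ => 1

/-- The `𝓡` Lorentz-Karamata space `L^𝓡_{p,r,b,q,a}`, with quasi-norm
`‖ t ^ (-1/r) b(t) ‖ u ^ (1/p - 1/q) a(u) f^*(u) ‖_{q, (t, ∞)} ‖_{r, (0, ∞)}`. -/
noncomputable def rLorentzKaramataSpace (p r : ℝ≥0∞) (b : ℝ → ℝ) (q : ℝ≥0∞) (a : ℝ → ℝ) :
    FunctionSpace μ 𝕜 :=
  .ofQNorm fun f => rNorm (1 / p).toReal r b q a (rearrangement f)

/-- The grand Lorentz-Karamata space `L^{p),q,r}_b`, with quasi-norm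
`‖ t ^ (-1/r) b(t) ‖ u ^ (1/p - 1/q) f^*(u) ‖_{q, (t, ∞)} ‖_{r, (0, ∞)}`. -/
noncomputable def grandLorentzKaramataSpace (p q r : ℝ≥0∞) (b : ℝ → ℝ) : FunctionSpace μ 𝕜 :=
  .ofQNorm fun f =>
    eLpNorm (fun t : ℝ => ENNReal.ofReal (t ^ (-(1 / r).toReal) * b t) *
        eLpNorm (fun u : ℝ =>
            ENNReal.ofReal (u ^ ((1 / p).toReal - (1 / q).toReal)) * rearrangement f u)
          q (volume.restrict (Ioi t)))
      r (volume.restrict (Ioi 0))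

variable {μ 𝕜}

/-- The algebraic sum `A₀ + A₁`. -/
def sumCarrier (A₀ A₁ : FunctionSpace μ 𝕜) : Set (Ω →ₘ[μ] 𝕜) :=
  {f | ∃ f₀ ∈ A₀.carrier, ∃ f₁ ∈ A₁.carrier, f = f₀ + f₁}

/-- Peetre's functional
`K(t, f; A₀, A₁) = inf {‖f₀‖_{A₀} + t ‖f₁‖_{A₁} : f = f₀ + f₁, f₀ ∈ A₀, f₁ ∈ A₁}`. -/
noncomputable def peetreK (A₀ A₁ : FunctionSpace μ 𝕜) (f : Ω →ₘ[μ] 𝕜) (t : ℝ) : ℝ≥0∞ :=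
  sInf {k : ℝ≥0∞ | ∃ f₀ ∈ A₀.carrier, ∃ f₁ ∈ A₁.carrier, f = f₀ + f₁ ∧
    k = A₀.qnorm f₀ + ENNReal.ofReal t * A₁.qnorm f₁}

/-- The `𝓡` limiting interpolation space `(A₀, A₁)^𝓡_{θ,r,b,q,a}`: all `f ∈ A₀ + A₁` with
`‖ t ^ (-1/r) b(t) ‖ u ^ (-θ - 1/q) a(u) K(u, f) ‖_{q, (t, ∞)} ‖_{r, (0, ∞)} < ∞`. -/
noncomputable def rInterpolationSpace (A₀ A₁ : FunctionSpace μ 𝕜) (θ : ℝ) (r : ℝ≥0∞)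
    (b : ℝ → ℝ) (q : ℝ≥0∞) (a : ℝ → ℝ) : FunctionSpace μ 𝕜 where
  carrier := {f | f ∈ sumCarrier A₀ A₁ ∧ rNorm (-θ) r b q a (peetreK A₀ A₁ f) < ∞}
  qnorm f := rNorm (-θ) r b q a (peetreK A₀ A₁ f)

end FunctionSpaces

/-!
Write `κ` for the first exponent. Splitting `f = f₀ + f₁` moves the rearrangement by at most
`‖f₁‖_∞`, so `t f^*(t^κ)` is a lower bound for `K(t, f; L_{κ,∞}, L_∞) ≤ K(t, f; L_κ, L_∞)`.

In the other direction, cut `f` at height `f^*(t^κ)` and split the set where `|f|` is larger into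
the layers between the heights `f^*((t / 2^k)^κ)`. For every `η < 1` this gives
`K(t, f; L_κ, L_∞) ≤ C t sup_k 2^{-ηk} f^*((t / 2^k)^κ)`. If the weights grow under dilation at most
like the powers `α` and `β`, dilating by `l ≥ 1` costs a factor `l^{1-θ+α+β}` in the iterated norm
of order `1 - θ`. When `α + β < θ` one can choose `η` between `1 - θ + α + β` and `1`, so the norms
of the weighted dilates decay geometrically and their supremum costs only a constant.

Both dilations and the final substitution `t ↦ t^κ` become affine changes of variable in `log t`,
in which the factors `t^{-1/r}` and `u^{-1/q}` are absorbed by the measures `dt/t` and `du/u`.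
-/

section Lp

variable {α : Type*} [MeasurableSpace α] {μ : Measure α} {f g : α → ℝ≥0∞} {q : ℝ≥0∞}

theorem eLpNorm_le_mul_of_ae_le {c : ℝ≥0∞} (hc : c ≠ ∞) (h : ∀ᵐ x ∂μ, f x ≤ c * g x) :
    eLpNorm f q μ ≤ c * eLpNorm g q μ := by
  lift c to ℝ≥0 using hc
  exact eLpNorm_le_mul_eLpNorm_of_ae_le_mul' h q

theorem eLpNorm_ennreal_const_mul {c : ℝ≥0∞} (hc0 : c ≠ 0) (hc : c ≠ ∞) (f : α → ℝ≥0∞) :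
    eLpNorm (fun x => c * f x) q μ = c * eLpNorm f q μ := by
  refine le_antisymm (eLpNorm_le_mul_of_ae_le hc (ae_of_all _ fun x => le_rfl)) ?_
  rw [mul_comm, ← ENNReal.le_div_iff_mul_le (.inl hc0) (.inl hc), ENNReal.div_eq_inv_mul]
  refine eLpNorm_le_mul_of_ae_le (ENNReal.inv_ne_top.2 hc0) (ae_of_all _ fun x => ?_)
  rw [← mul_assoc, ENNReal.inv_mul_cancel hc0 hc, one_mul]

theorem eLpNorm_top_iSup_le {ι : Type*} [Countable ι] (ψ : ι → α → ℝ≥0∞) :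
    eLpNorm (fun x => ⨆ i, ψ i x) ∞ μ ≤ ⨆ i, eLpNorm (ψ i) ∞ μ := by
  simp only [eLpNorm_exponent_top]
  refine essSup_le_of_ae_le _ ?_
  filter_upwards [ae_all_iff.2 fun i => enorm_ae_le_eLpNormEssSup (ψ i) μ] with x hx
  exact iSup_mono hx

theorem eLpNorm_iSup_rpow_le_tsum {ι : Type*} [Countable ι] (hq : q ≠ 0) (hq' : q ≠ ∞)
    {ψ : ι → α → ℝ≥0∞} (hψ : ∀ i, AEMeasurable (ψ i) μ) :
    eLpNorm (fun x => ⨆ i, ψ i x) q μ ^ q.toReal ≤ ∑' i, eLpNorm (ψ i) q μ ^ q.toReal := by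
  have hq0 : 0 < q.toReal := ENNReal.toReal_pos hq hq'
  simp only [eLpNorm_eq_lintegral_rpow_enorm_toReal hq hq', ← ENNReal.rpow_mul, enorm_eq_self,
    one_div_mul_cancel hq0.ne', ENNReal.rpow_one]
  rw [← lintegral_tsum fun i => (hψ i).pow_const _]
  gcongr with x
  rw [← ENNReal.le_rpow_inv_iff hq0]
  exact iSup_le fun i => (ENNReal.le_rpow_inv_iff hq0).2 (ENNReal.le_tsum i)

theorem tsum_pow_ne_top {ρ : ℝ≥0∞} (hρ : ρ < 1) : ∑' k : ℕ, ρ ^ k ≠ ∞ := by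
  rw [ENNReal.tsum_geometric]
  exact ENNReal.inv_ne_top.2 (tsub_pos_of_lt hρ).ne'

variable (α) in
theorem exists_eLpNorm_iSup_le (hq : q ≠ 0) {ρ : ℝ≥0} (hρ : 1 < ρ) :
    ∃ C : ℝ≥0, ∀ (μ : Measure α) (ψ : ℕ → α → ℝ≥0∞), (∀ k, AEMeasurable (ψ k) μ) →
      eLpNorm (fun x => ⨆ k, ψ k x) q μ ≤ C * ⨆ k, (ρ : ℝ≥0∞) ^ k * eLpNorm (ψ k) q μ := by
  rcases eq_or_ne q ∞ with rfl | hq'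
  · refine ⟨1, fun μ ψ _ => (eLpNorm_top_iSup_le ψ).trans ?_⟩
    rw [ENNReal.coe_one, one_mul]
    exact iSup_mono fun k => le_mul_of_one_le_left' (one_le_pow₀ (mod_cast hρ.le))
  have hq0 : 0 < q.toReal := ENNReal.toReal_pos hq hq'
  set T : ℝ≥0∞ := (∑' k : ℕ, (((ρ : ℝ≥0∞)⁻¹) ^ q.toReal) ^ k) ^ q.toReal⁻¹ with hT
  have hT' : T ≠ ∞ := ENNReal.rpow_ne_top_of_nonneg (by positivity)
    (tsum_pow_ne_top (ENNReal.rpow_lt_one (ENNReal.inv_lt_one.2 (mod_cast hρ)) hq0))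
  refine ⟨T.toNNReal, fun μ ψ hψ => ?_⟩
  set S : ℝ≥0∞ := ⨆ k, (ρ : ℝ≥0∞) ^ k * eLpNorm (ψ k) q μ
  have hdecay : ∀ k, eLpNorm (ψ k) q μ ≤ (ρ : ℝ≥0∞)⁻¹ ^ k * S := fun k => by
    have hρ0 : ρ ^ k ≠ 0 := pow_ne_zero k (zero_lt_one.trans hρ).ne'
    rw [← ENNReal.inv_pow, ← ENNReal.mul_le_iff_le_inv (mod_cast hρ0) (by finiteness)]
    exact le_iSup (fun k => (ρ : ℝ≥0∞) ^ k * eLpNorm (ψ k) q μ) k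
  rw [ENNReal.coe_toNNReal hT', ← ENNReal.rpow_le_rpow_iff hq0]
  calc eLpNorm (fun x => ⨆ k, ψ k x) q μ ^ q.toReal
      ≤ ∑' k, eLpNorm (ψ k) q μ ^ q.toReal := eLpNorm_iSup_rpow_le_tsum hq hq' hψ
    _ ≤ ∑' k, ((ρ : ℝ≥0∞)⁻¹ ^ k * S) ^ q.toReal := by gcongr with k; exact hdecay k
    _ = ∑' k, ((ρ : ℝ≥0∞)⁻¹ ^ q.toReal) ^ k * S ^ q.toReal := by
      simp only [ENNReal.mul_rpow_of_nonneg _ _ hq0.le, ← ENNReal.rpow_natCast, ← ENNReal.rpow_mul,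
        mul_comm q.toReal]
    _ = (T * S) ^ q.toReal := by
      rw [ENNReal.tsum_mul_right, ENNReal.mul_rpow_of_nonneg _ _ hq0.le, hT,
        ENNReal.rpow_inv_rpow hq0.ne']

theorem eLpNorm_rpow_neg_mul_withDensity {w : α → ℝ≥0∞} (hw : Measurable w) (hw0 : ∀ x, w x ≠ 0)
    (hw' : ∀ x, w x ≠ ∞) (hq : q ≠ 0) (g : α → ℝ≥0∞) :
    eLpNorm (fun x => w x ^ (-(1 / q).toReal) * g x) q (μ.withDensity w) = eLpNorm g q μ := by
  rcases eq_or_ne q ∞ with rfl | hq'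
  · simp only [ENNReal.div_top, ENNReal.toReal_zero, neg_zero, ENNReal.rpow_zero, one_mul,
      eLpNorm_exponent_top, eLpNormEssSup]
    exact le_antisymm (essSup_mono_measure (withDensity_absolutelyContinuous μ w))
      (essSup_mono_measure (withDensity_absolutelyContinuous' hw.aemeasurable (ae_of_all _ hw0)))
  · have hq0 : 0 < q.toReal := ENNReal.toReal_pos hq hq'
    rw [eLpNorm_eq_lintegral_rpow_enorm_toReal hq hq',
      eLpNorm_eq_lintegral_rpow_enorm_toReal hq hq',
      lintegral_withDensity_eq_lintegral_mul_non_measurable _ hw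
        (ae_of_all _ fun x => (hw' x).lt_top)]
    congr 1
    refine lintegral_congr fun x => ?_
    have hexp : -(1 / q).toReal * q.toReal = -1 := by
      rw [one_div, ENNReal.toReal_inv, neg_mul, inv_mul_cancel₀ hq0.ne']
    rw [Pi.mul_apply, enorm_eq_self, enorm_eq_self, ENNReal.mul_rpow_of_nonneg _ _ hq0.le,
      ← ENNReal.rpow_mul, hexp, ENNReal.rpow_neg_one, ← mul_assoc,
      ENNReal.mul_inv_cancel (hw0 x) (hw' x), one_mul]

end Lp

section LogarithmicCoordinates

variable {q r : ℝ≥0∞}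

theorem antitone_eLpNorm_Ioi (q : ℝ≥0∞) (ψ : ℝ → ℝ≥0∞) :
    Antitone fun y : ℝ => eLpNorm ψ q (volume.restrict (Ioi y)) := fun _ _ h =>
  eLpNorm_mono_measure _ (Measure.restrict_mono (Ioi_subset_Ioi h) le_rfl)

theorem volume_restrict_image_exp {s : Set ℝ} (hs : MeasurableSet s) :
    volume.restrict (Real.exp '' s) = Measure.map Real.exp
      ((volume.restrict s).withDensity fun x => ENNReal.ofReal (Real.exp x)) := by
  rw [← map_withDensity_abs_det_fderiv_eq_addHaar volume hs.nullMeasurableSet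
    (fun x _ => (Real.hasDerivAt_exp x).hasDerivWithinAt.hasFDerivWithinAt)
    Real.exp_injective.injOn]
  simp

theorem weightedNorm_image_exp (σ : ℝ) (hq : q ≠ 0) (a : ℝ → ℝ) (φ : ℝ → ℝ≥0∞) {s : Set ℝ}
    (hs : MeasurableSet s) :
    weightedNorm σ q a φ (Real.exp '' s) = eLpNorm (fun x => ENNReal.ofReal
      (Real.exp (σ * x) * a (Real.exp x)) * φ (Real.exp x)) q (volume.restrict s) := by
  rw [← eLpNorm_rpow_neg_mul_withDensity (w := fun x => ENNReal.ofReal (Real.exp x))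
      (by fun_prop) (by simp [Real.exp_pos]) (by simp) hq, weightedNorm,
    volume_restrict_image_exp hs,
    Real.isOpenEmbedding_exp.measurableEmbedding.eLpNorm_map_measure]
  congr 1
  funext x
  rw [Function.comp_apply, ENNReal.ofReal_rpow_of_pos (Real.exp_pos x), ← mul_assoc,
    ← ENNReal.ofReal_mul (by positivity), ← mul_assoc, ← Real.exp_mul, ← Real.exp_mul,
    ← Real.exp_add]
  ring_nf

/-- The iterated quasi-norm `‖ B(y) ‖ ψ ‖_{q, (y, ∞)} ‖_r` over the real line, without power
weights: what `rNorm` becomes under the substitutions `t = e ^ y`, `u = e ^ x`, which turn dilations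
and powers of the variable into affine maps. -/
noncomputable def logTailNorm (r q : ℝ≥0∞) (B ψ : ℝ → ℝ≥0∞) : ℝ≥0∞ :=
  eLpNorm (fun y => B y * eLpNorm ψ q (volume.restrict (Ioi y))) r volume

theorem rNorm_eq_logTailNorm (σ : ℝ) (hr : r ≠ 0) (b : ℝ → ℝ) (hq : q ≠ 0) (a : ℝ → ℝ)
    (φ : ℝ → ℝ≥0∞) :
    rNorm σ r b q a φ = logTailNorm r q (fun y => ENNReal.ofReal (b (Real.exp y)))
      (fun x => ENNReal.ofReal (Real.exp (σ * x) * a (Real.exp x)) * φ (Real.exp x)) := by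
  have hIoi : Ioi (0 : ℝ) = Real.exp '' univ := by rw [image_univ, Real.range_exp]
  rw [rNorm, hIoi, weightedNorm_image_exp 0 hr b _ MeasurableSet.univ, logTailNorm,
    Measure.restrict_univ]
  simp only [zero_mul, Real.exp_zero, one_mul, ← Real.image_exp_Ioi,
    weightedNorm_image_exp σ hq a φ measurableSet_Ioi]

theorem logTailNorm_comp {e : ℝ → ℝ} (he : MeasurableEmbedding e) (hmono : StrictMono e)
    {c : ℝ≥0∞} (hc0 : c ≠ 0) (hc : c ≠ ∞) (hmap : Measure.map e volume = c • volume)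
    (B ψ : ℝ → ℝ≥0∞) :
    logTailNorm r q (fun y => B (e y)) (fun x => ψ (e x)) =
      c ^ (1 / r).toReal * c ^ (1 / q).toReal * logTailNorm r q B ψ := by
  have hinner : ∀ y, eLpNorm (fun x => ψ (e x)) q (volume.restrict (Ioi y)) =
      c ^ (1 / q).toReal * eLpNorm ψ q (volume.restrict (Ioi (e y))) := fun y => by
    have hrestrict : Measure.map e (volume.restrict (Ioi y)) = c • volume.restrict (Ioi (e y)) := by
      have hpre : e ⁻¹' Ioi (e y) = Ioi y := by ext x; simp [hmono.lt_iff_lt]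
      rw [← Measure.restrict_smul, ← hmap, he.restrict_map, hpre]
    rw [← smul_eq_mul, ← eLpNorm_smul_measure_of_ne_zero hc0, ← hrestrict, he.eLpNorm_map_measure]
    rfl
  have hcq0 : c ^ (1 / q).toReal ≠ 0 := by simp [ENNReal.rpow_eq_zero_iff, hc0, hc]
  have hcq : c ^ (1 / q).toReal ≠ ∞ := ENNReal.rpow_ne_top_of_nonneg (by positivity) hc
  simp only [logTailNorm, hinner, mul_left_comm (B _)]
  rw [eLpNorm_ennreal_const_mul hcq0 hcq, mul_comm (c ^ (1 / r).toReal), mul_assoc,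
    ← smul_eq_mul (c ^ (1 / r).toReal), ← eLpNorm_smul_measure_of_ne_zero hc0, ← hmap,
    he.eLpNorm_map_measure]
  rfl

theorem rNorm_comp_div (σ : ℝ) (hr : r ≠ 0) (b : ℝ → ℝ) (hq : q ≠ 0) (a : ℝ → ℝ)
    (φ : ℝ → ℝ≥0∞) {l : ℝ} (hl : 0 < l) :
    rNorm σ r b q a (fun t => φ (t / l)) =
      rNorm σ r (fun t => b (l * t)) q (fun t => l ^ σ * a (l * t)) φ := by
  have hexp : ∀ x, Real.exp (x + Real.log l) = l * Real.exp x := fun x => by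
    rw [Real.exp_add, Real.exp_log hl, mul_comm]
  have hexpσ : ∀ x, Real.exp (σ * (x + Real.log l)) = Real.exp (σ * x) * l ^ σ := fun x => by
    rw [mul_add, Real.exp_add, Real.rpow_def_of_pos hl, mul_comm σ (Real.log l)]
  have hshift := logTailNorm_comp (r := r) (q := q) (e := fun x => x + Real.log l)
    (MeasurableEquiv.addRight (Real.log l)).measurableEmbedding
    (fun x y hxy => by simpa using hxy) one_ne_zero ENNReal.one_ne_top
    (by simp [map_add_right_eq_self]) (fun y => ENNReal.ofReal (b (Real.exp y)))
    (fun x => ENNReal.ofReal (Real.exp (σ * x) * a (Real.exp x)) * φ (Real.exp x / l))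
  simp only [ENNReal.one_rpow, one_mul, hexp, hexpσ, mul_div_cancel_left₀ _ hl.ne'] at hshift
  simp only [rNorm_eq_logTailNorm σ hr _ hq, ← hshift, mul_assoc]

theorem exists_rNorm_comp_rpow_eq (σ : ℝ) (hr : r ≠ 0) (b : ℝ → ℝ) (hq : q ≠ 0) (a : ℝ → ℝ)
    {κ : ℝ} (hκ : 0 < κ) :
    ∃ c : ℝ≥0∞, c ≠ 0 ∧ c ≠ ∞ ∧ ∀ φ : ℝ → ℝ≥0∞, rNorm σ r b q a (fun t => φ (t ^ κ)) =
      c * rNorm (σ / κ) r (fun t => b (t ^ (1 / κ))) q (fun t => a (t ^ (1 / κ))) φ := by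
  set d : ℝ≥0∞ := ENNReal.ofReal |κ⁻¹|
  have hd0 : d ≠ 0 := by simp [d, hκ.ne']
  have hd : ∀ s : ℝ, d ^ s ≠ 0 ∧ d ^ s ≠ ∞ := fun s =>
    ⟨by simp [ENNReal.rpow_eq_zero_iff, hκ.ne', d], by simp [ENNReal.rpow_eq_top_iff, hκ.ne', d]⟩
  refine ⟨d ^ (1 / r).toReal * d ^ (1 / q).toReal, mul_ne_zero (hd _).1 (hd _).1,
    ENNReal.mul_ne_top (hd _).2 (hd _).2, fun φ => ?_⟩
  have hexp : ∀ x, Real.exp (κ * x) ^ (1 / κ) = Real.exp x := fun x => by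
    rw [← Real.exp_mul]
    field_simp
  have hexpκ : ∀ x, Real.exp x ^ κ = Real.exp (κ * x) := fun x => by
    rw [← Real.exp_mul, mul_comm]
  have hσ : ∀ x, σ / κ * (κ * x) = σ * x := fun x => by field_simp
  rw [rNorm_eq_logTailNorm _ hr _ hq, rNorm_eq_logTailNorm _ hr _ hq,
    ← logTailNorm_comp (e := fun x => κ * x) (Homeomorph.mulLeft₀ κ hκ.ne').measurableEmbedding
      (fun x y hxy => mul_lt_mul_of_pos_left hxy hκ) hd0 ENNReal.ofReal_ne_top
      (Real.map_volume_mul_left hκ.ne')]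
  simp only [hexp, hexpκ, hσ]

end LogarithmicCoordinates

section IteratedNorm

variable {σ : ℝ} {q r : ℝ≥0∞} {ρ : ℝ≥0} {a a' b b' : ℝ → ℝ} {φ ψ : ℝ → ℝ≥0∞} {s : Set ℝ}

theorem weightedNorm_le_mul_of_le (hs : MeasurableSet s) (hs0 : s ⊆ Ioi 0) {C D : ℝ≥0}
    (ha : ∀ t ∈ s, a t ≤ C * a' t) (hφ : ∀ t ∈ s, φ t ≤ D * ψ t) :
    weightedNorm σ q a φ s ≤ C * D * weightedNorm σ q a' ψ s := by
  refine eLpNorm_le_mul_of_ae_le (ENNReal.mul_ne_top ENNReal.coe_ne_top ENNReal.coe_ne_top)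
    (ae_restrict_of_forall_mem hs fun t ht => ?_)
  have ht0 : 0 < t := hs0 ht
  rw [mul_mul_mul_comm, ← ENNReal.ofReal_coe_nnreal, ← ENNReal.ofReal_mul C.coe_nonneg,
    mul_left_comm (C : ℝ)]
  gcongr
  exacts [ha t ht, hφ t ht]

theorem weightedNorm_le_mul (hs : MeasurableSet s) (hs0 : s ⊆ Ioi 0) {D : ℝ≥0}
    (hφ : ∀ t ∈ s, φ t ≤ D * ψ t) : weightedNorm σ q a φ s ≤ D * weightedNorm σ q a ψ s := by
  simpa using weightedNorm_le_mul_of_le (C := 1) (a := a) (a' := a) hs hs0 (by simp) hφ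

theorem rNorm_le_mul_of_le {A B D : ℝ≥0} (hb : ∀ t, 0 < t → b t ≤ B * b' t)
    (ha : ∀ t, 0 < t → a t ≤ A * a' t) (hφ : ∀ t, 0 < t → φ t ≤ D * ψ t) :
    rNorm σ r b q a φ ≤ B * (A * D : ℝ≥0) * rNorm σ r b' q a' ψ := by
  refine weightedNorm_le_mul_of_le measurableSet_Ioi subset_rfl hb
    fun t (ht : 0 < t) => ?_
  rw [ENNReal.coe_mul]
  exact weightedNorm_le_mul_of_le measurableSet_Ioi (Ioi_subset_Ioi ht.le)
    (fun u hu => ha u (ht.trans hu)) fun u hu => hφ u (ht.trans hu)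

theorem rNorm_le_mul {D : ℝ≥0} (hφ : ∀ t, 0 < t → φ t ≤ D * ψ t) :
    rNorm σ r b q a φ ≤ D * rNorm σ r b q a ψ := by
  simpa using rNorm_le_mul_of_le (A := 1) (B := 1) (b := b) (b' := b) (a := a) (a' := a)
    (by simp) (by simp) hφ

theorem rNorm_mono (hφ : ∀ t, 0 < t → φ t ≤ ψ t) : rNorm σ r b q a φ ≤ rNorm σ r b q a ψ := by
  simpa using rNorm_le_mul (D := 1) (by simpa using hφ)

theorem weightedNorm_ofReal_mul (σ : ℝ) (q : ℝ≥0∞) (a : ℝ → ℝ) (φ : ℝ → ℝ≥0∞)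
    (hs : MeasurableSet s) (hs0 : s ⊆ Ioi 0) :
    weightedNorm σ q a (fun t => ENNReal.ofReal t * φ t) s = weightedNorm (σ + 1) q a φ s := by
  refine eLpNorm_congr_ae (ae_restrict_of_forall_mem hs fun t ht => ?_)
  have ht : 0 < t := hs0 ht
  beta_reduce
  rw [← mul_assoc, ← ENNReal.ofReal_mul' ht.le, mul_right_comm, ← Real.rpow_add_one ht.ne',
    sub_add_eq_add_sub]

theorem rNorm_ofReal_mul (σ : ℝ) (r : ℝ≥0∞) (b : ℝ → ℝ) (q : ℝ≥0∞) (a : ℝ → ℝ) (φ : ℝ → ℝ≥0∞) :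
    rNorm σ r b q a (fun t => ENNReal.ofReal t * φ t) = rNorm (σ + 1) r b q a φ := by
  refine eLpNorm_congr_ae (ae_restrict_of_forall_mem measurableSet_Ioi fun t (ht : 0 < t) => ?_)
  beta_reduce
  rw [weightedNorm_ofReal_mul _ _ _ _ measurableSet_Ioi (Ioi_subset_Ioi ht.le)]

theorem exists_weightedNorm_iSup_le (σ : ℝ) (hq : q ≠ 0)
    (ha : AEMeasurable a (volume.restrict (Ioi 0))) (hρ : 1 < ρ) :
    ∃ C : ℝ≥0, ∀ s ⊆ Ioi 0, ∀ φ : ℕ → ℝ → ℝ≥0∞,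
      (∀ k, AEMeasurable (φ k) (volume.restrict (Ioi 0))) →
      weightedNorm σ q a (fun t => ⨆ k, φ k t) s ≤
        C * ⨆ k, (ρ : ℝ≥0∞) ^ k * weightedNorm σ q a (φ k) s := by
  obtain ⟨C, hC⟩ := exists_eLpNorm_iSup_le ℝ hq hρ
  refine ⟨C, fun s hs φ hφ => ?_⟩
  have hmeas : ∀ k, AEMeasurable
      (fun t => ENNReal.ofReal (t ^ (σ - (1 / q).toReal) * a t) * φ k t) (volume.restrict s) :=
    fun k => (((by fun_prop : Measurable fun t : ℝ => t ^ (σ - (1 / q).toReal)).aemeasurable.mul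
      ha).ennreal_ofReal.mul (hφ k)).mono_set hs
  simpa only [weightedNorm, ENNReal.mul_iSup] using hC _ _ hmeas

theorem exists_rNorm_iSup_le (σ : ℝ) (hr : r ≠ 0) (hb : AEMeasurable b (volume.restrict (Ioi 0)))
    (hq : q ≠ 0) (ha : AEMeasurable a (volume.restrict (Ioi 0))) (hρ : 1 < ρ) :
    ∃ C : ℝ≥0, ∀ φ : ℕ → ℝ → ℝ≥0∞, (∀ k, AEMeasurable (φ k) (volume.restrict (Ioi 0))) →
      rNorm σ r b q a (fun t => ⨆ k, φ k t) ≤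
        C * ⨆ k, (ρ : ℝ≥0∞) ^ k * rNorm σ r b q a (φ k) := by
  set τ : ℝ≥0 := NNReal.sqrt ρ
  have hτ : 1 < τ := by simpa only [NNReal.sqrt_one] using NNReal.sqrt_lt_sqrt.2 hρ
  obtain ⟨C₁, hinner⟩ := exists_weightedNorm_iSup_le σ hq ha hτ
  obtain ⟨C₂, houter⟩ := exists_weightedNorm_iSup_le 0 hr hb hτ
  refine ⟨C₁ * C₂, fun φ hφ => ?_⟩
  set ψ : ℕ → ℝ → ℝ≥0∞ := fun k t => (τ ^ k : ℝ≥0) * weightedNorm σ q a (φ k) (Ioi t)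
  have hψ : ∀ k, weightedNorm 0 r b (ψ k) (Ioi 0) ≤ (τ : ℝ≥0∞) ^ k * rNorm σ r b q a (φ k) :=
    fun k => by
      rw [← ENNReal.coe_pow]
      exact weightedNorm_le_mul measurableSet_Ioi subset_rfl fun t _ => le_rfl
  calc rNorm σ r b q a (fun t => ⨆ k, φ k t)
      ≤ C₁ * weightedNorm 0 r b (fun t => ⨆ k, ψ k t) (Ioi 0) := by
        refine weightedNorm_le_mul measurableSet_Ioi subset_rfl fun t (ht : 0 < t) => ?_
        simpa only [ψ, ENNReal.coe_pow] using hinner _ (Ioi_subset_Ioi ht.le) φ hφ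
    _ ≤ C₁ * (C₂ * ⨆ k, (τ : ℝ≥0∞) ^ k * weightedNorm 0 r b (ψ k) (Ioi 0)) := by
        gcongr
        exact houter _ subset_rfl ψ
          fun k => ((antitone_eLpNorm_Ioi q _).measurable.const_mul _).aemeasurable
    _ ≤ C₁ * (C₂ * ⨆ k, (τ : ℝ≥0∞) ^ k * (τ ^ k * rNorm σ r b q a (φ k))) := by
        gcongr with k
        exact hψ k
    _ = (C₁ * C₂ : ℝ≥0) * ⨆ k, (ρ : ℝ≥0∞) ^ k * rNorm σ r b q a (φ k) := by
        rw [ENNReal.coe_mul, mul_assoc, ← NNReal.mul_self_sqrt ρ]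
        simp only [ENNReal.coe_mul, mul_pow, mul_assoc, τ]

theorem weightedNorm_top (hq : q ≠ 0) (ha : ∀ t ∈ s, 0 < a t) (hs : MeasurableSet s)
    (hs0 : s ⊆ Ioi 0) (hvol : volume s ≠ 0) (hφ : ∀ t ∈ s, φ t = ∞) :
    weightedNorm σ q a φ s = ∞ := by
  have hconst : weightedNorm σ q a φ s = eLpNorm (fun _ => (∞ : ℝ≥0∞)) q (volume.restrict s) := by
    refine eLpNorm_congr_ae (ae_restrict_of_forall_mem hs fun t ht => ?_)
    have := Real.rpow_pos_of_pos (hs0 ht) (σ - (1 / q).toReal)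
    beta_reduce
    rw [hφ t ht, ENNReal.mul_top (ENNReal.ofReal_pos.2 (mul_pos this (ha t ht))).ne']
  rw [hconst, eLpNorm_const _ hq (by simpa using hvol)]
  refine ENNReal.top_mul ?_
  simp [hvol]

theorem rNorm_top (hq : q ≠ 0) (hr : r ≠ 0) (ha : ∀ t, 0 < t → 0 < a t)
    (hb : ∀ t, 0 < t → 0 < b t) : rNorm σ r b q a (fun _ => ∞) = ∞ := by
  refine weightedNorm_top hr hb measurableSet_Ioi subset_rfl (by simp) fun t (ht : 0 < t) => ?_
  exact weightedNorm_top hq (fun u hu => ha u (ht.trans hu)) measurableSet_Ioi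
    (Ioi_subset_Ioi ht.le) (by simp) fun _ _ => rfl

end IteratedNorm

/-- A positive measurable weight on `(0, ∞)` that grows under dilation at most like the power `α`:
`w (l * t) ≤ C * l ^ α * w t` for `l ≥ 1`. Slowly varying weights have every order `α > 0`, and this
upper bound is the only part of slow variation that the interpolation formula uses. -/
structure IsPowerBoundedWeight (α : ℝ) (w : ℝ → ℝ) : Prop where
  pos : ∀ t : ℝ, 0 < t → 0 < w t
  aemeasurable : AEMeasurable w (volume.restrict (Ioi 0))
  exists_comp_mul_le : ∃ C : ℝ≥0, ∀ l t : ℝ, 1 ≤ l → 0 < t → w (l * t) ≤ C * l ^ α * w t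

theorem IsPowerBoundedWeight.one : IsPowerBoundedWeight 0 fun _ => 1 where
  pos _ _ := one_pos
  aemeasurable := aemeasurable_const
  exists_comp_mul_le := ⟨1, by simp⟩

theorem IsSlowlyVarying.isPowerBoundedWeight {w : ℝ → ℝ} (hw : IsSlowlyVarying w) {ε : ℝ}
    (hε : 0 < ε) : IsPowerBoundedWeight ε w where
  pos := hw.pos
  aemeasurable := hw.aemeasurable
  exists_comp_mul_le := by
    obtain ⟨g, hg, c, C, hc, hC, hgw⟩ := hw.equiv_decreasing ε hε
    refine ⟨(C / c).toNNReal, fun l t hl ht => ?_⟩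
    have hl0 : 0 < l := one_pos.trans_le hl
    have hlt : 0 < l * t := mul_pos hl0 ht
    have hdecr : (l * t) ^ (-ε) * w (l * t) ≤ C / c * (t ^ (-ε) * w t) := by
      rw [div_mul_eq_mul_div, le_div_iff₀' hc]
      calc c * ((l * t) ^ (-ε) * w (l * t))
          ≤ c * (C * g (l * t)) := mul_le_mul_of_nonneg_left (hgw _ hlt).2 hc.le
        _ = C * (c * g (l * t)) := mul_left_comm ..
        _ ≤ C * (c * g t) := by gcongr; exact hg ht hlt (le_mul_of_one_le_left ht.le hl)
        _ ≤ C * (t ^ (-ε) * w t) := mul_le_mul_of_nonneg_left (hgw _ ht).1 hC.le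
    have hcancel : ∀ s : ℝ, 0 < s → s ^ ε * (s ^ (-ε) * w s) = w s := fun s hs => by
      rw [← mul_assoc, ← Real.rpow_add hs, add_neg_cancel, Real.rpow_zero, one_mul]
    rw [Real.coe_toNNReal _ (by positivity)]
    calc w (l * t) = (l * t) ^ ε * ((l * t) ^ (-ε) * w (l * t)) := (hcancel _ hlt).symm
      _ ≤ (l * t) ^ ε * (C / c * (t ^ (-ε) * w t)) := by gcongr
      _ = C / c * l ^ ε * (t ^ ε * (t ^ (-ε) * w t)) := by
        rw [Real.mul_rpow hl0.le ht.le]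
        ring
      _ = C / c * l ^ ε * w t := by rw [hcancel t ht]

theorem exists_rNorm_comp_div_le (σ : ℝ) {q r : ℝ≥0∞} (hr : r ≠ 0) {β : ℝ} {b : ℝ → ℝ}
    (hb : IsPowerBoundedWeight β b) (hq : q ≠ 0) {α : ℝ} {a : ℝ → ℝ}
    (ha : IsPowerBoundedWeight α a) :
    ∃ C : ℝ≥0, ∀ (φ : ℝ → ℝ≥0∞) (l : ℝ≥0), 1 ≤ l → rNorm σ r b q a (fun t => φ (t / l)) ≤
      C * (l : ℝ≥0∞) ^ (σ + α + β) * rNorm σ r b q a φ := by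
  obtain ⟨A, hA⟩ := ha.exists_comp_mul_le
  obtain ⟨B, hB⟩ := hb.exists_comp_mul_le
  refine ⟨B * A, fun φ l hl => ?_⟩
  have hl0 : 0 < l := one_pos.trans_le hl
  rw [rNorm_comp_div σ hr b hq a φ (NNReal.coe_pos.2 hl0)]
  calc rNorm σ r (fun t => b (l * t)) q (fun t => l ^ σ * a (l * t)) φ
      ≤ (B * l ^ β : ℝ≥0) * (l ^ σ * (A * l ^ α) * 1 : ℝ≥0) * rNorm σ r b q a φ := by
        refine rNorm_le_mul_of_le (fun t ht => ?_) (fun t ht => ?_) (by simp)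
        · exact mod_cast hB l t (mod_cast hl) ht
        · push_cast
          rw [mul_assoc]
          gcongr
          exact hA l t (mod_cast hl) ht
    _ = (B * A : ℝ≥0) * (l : ℝ≥0∞) ^ (σ + α + β) * rNorm σ r b q a φ := by
        rw [← ENNReal.coe_rpow_of_ne_zero hl0.ne', ← ENNReal.coe_mul, ← ENNReal.coe_mul,
          NNReal.rpow_add hl0.ne', NNReal.rpow_add hl0.ne']
        ring_nf

section Rearrangement

variable {Ω : Type*} [MeasurableSpace Ω] {μ : Measure Ω} {𝕜 : Type*} [RCLike 𝕜] {p : ℝ≥0∞}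

theorem antitone_rearrangement (f : Ω →ₘ[μ] 𝕜) : Antitone (rearrangement f) := fun _ _ h =>
  sInf_le_sInf fun _ hs => le_trans hs (ENNReal.ofReal_le_ofReal h)

theorem measure_rearrangement_lt_le (f : Ω →ₘ[μ] 𝕜) (t : ℝ) :
    μ {x | rearrangement f t < ‖f x‖ₑ} ≤ ENNReal.ofReal t := by
  obtain ⟨u, hu, hlim, hmem⟩ := exists_seq_tendsto_sInf
    (S := {s : ℝ≥0∞ | μ {x | s < ‖f x‖ₑ} ≤ ENNReal.ofReal t}) ⟨∞, by simp⟩ (OrderBot.bddBelow _)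
  have hunion : {x | rearrangement f t < ‖f x‖ₑ} = ⋃ n, {x | u n < ‖f x‖ₑ} := by
    ext x
    rw [mem_iUnion]
    exact ⟨fun hx => (hlim.eventually (gt_mem_nhds hx)).exists,
      fun ⟨n, hn⟩ => (sInf_le (hmem n)).trans_lt hn⟩
  have hmono : Monotone fun n => {x | u n < ‖f x‖ₑ} := fun m n hmn x hx => (hu hmn).trans_lt hx
  rw [hunion, hmono.measure_iUnion]
  exact iSup_le hmem

theorem rearrangement_le_iff {f : Ω →ₘ[μ] 𝕜} {t : ℝ} {s : ℝ≥0∞} :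
    rearrangement f t ≤ s ↔ μ {x | s < ‖f x‖ₑ} ≤ ENNReal.ofReal t :=
  ⟨fun h => (measure_mono fun _ hx => h.trans_lt hx).trans (measure_rearrangement_lt_le f t),
    fun h => sInf_le h⟩

theorem rearrangement_add_le (f g : Ω →ₘ[μ] 𝕜) (t : ℝ) :
    rearrangement (f + g) t ≤ rearrangement f t + eLpNorm g ∞ μ := by
  refine rearrangement_le_iff.2 ((measure_mono_ae ?_).trans (measure_rearrangement_lt_le f t))
  filter_upwards [AEEqFun.coeFn_add f g, enorm_ae_le_eLpNormEssSup g μ] with x hadd hg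
  intro (hlt : _ < ‖(f + g : Ω →ₘ[μ] 𝕜) x‖ₑ)
  rw [hadd, Pi.add_apply, eLpNorm_exponent_top] at hlt
  by_contra hf
  exact hlt.not_ge ((enorm_add_le _ _).trans (add_le_add (not_lt.1 hf) hg))

theorem eLpNorm_top_restrict_compl_rearrangement_lt_le (f : Ω →ₘ[μ] 𝕜) (t : ℝ) :
    eLpNorm f ∞ (μ.restrict {x | rearrangement f t < ‖f x‖ₑ}ᶜ) ≤ rearrangement f t := by
  rw [eLpNorm_exponent_top]
  refine essSup_le_of_ae_le _ (ae_restrict_of_forall_mem ?_ fun x hx => not_lt.1 hx)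
  exact (measurableSet_lt measurable_const f.measurable.enorm).compl

theorem ofReal_rpow_mul_rearrangement_le_eLpNorm (hp : p ≠ 0) (f : Ω →ₘ[μ] 𝕜) {t : ℝ}
    (ht : 0 < t) :
    ENNReal.ofReal (t ^ (1 / p).toReal) * rearrangement f t ≤ eLpNorm f p μ := by
  rcases eq_or_ne p ∞ with rfl | hp'
  · have hzero : μ {x | eLpNorm f ∞ μ < ‖f x‖ₑ} = 0 := by
      simpa [ae_iff, eLpNorm_exponent_top] using enorm_ae_le_eLpNormEssSup f μ
    simpa using rearrangement_le_iff.2 (hzero.trans_le zero_le)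
  have hp0 : 0 < p.toReal := ENNReal.toReal_pos hp hp'
  have hroot : ENNReal.ofReal (t ^ (1 / p).toReal) ^ p.toReal = ENNReal.ofReal t := by
    rw [one_div, ENNReal.toReal_inv, ← ENNReal.ofReal_rpow_of_pos ht,
      ENNReal.rpow_inv_rpow hp0.ne']
  have hroot0 : ENNReal.ofReal (t ^ (1 / p).toReal) ≠ 0 := by
    simpa using Real.rpow_pos_of_pos ht _
  rw [mul_comm, ← ENNReal.le_div_iff_mul_le (.inl hroot0) (.inl ENNReal.ofReal_ne_top)]
  refine le_of_forall_lt_imp_le_of_dense fun s hs => ?_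
  rw [ENNReal.le_div_iff_mul_le (.inl hroot0) (.inl ENNReal.ofReal_ne_top),
    ← ENNReal.rpow_le_rpow_iff hp0, ENNReal.mul_rpow_of_nonneg _ _ hp0.le, hroot]
  have hlevel : ENNReal.ofReal t ≤ μ {x | s ≤ ‖f x‖ₑ} :=
    (not_le.1 (rearrangement_le_iff.not.1 hs.not_ge)).le.trans
      (measure_mono fun _ (hx : s < _) => hx.le)
  exact (mul_le_mul_right hlevel _).trans
    (mul_meas_ge_le_pow_eLpNorm' μ hp hp' f.aestronglyMeasurable s)

theorem ofReal_rpow_mul_le_weightedNorm_top {σ : ℝ} {φ : ℝ → ℝ≥0∞} (hφ : AntitoneOn φ (Ioi 0))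
    {t : ℝ} (ht : 0 < t) :
    ENNReal.ofReal (t ^ σ) * φ t ≤ weightedNorm σ ∞ (fun _ => 1) φ (Ioi 0) := by
  set N := weightedNorm σ ∞ (fun _ => 1) φ (Ioi 0)
  have hae : ∀ᵐ u : ℝ, 0 < u → ENNReal.ofReal (u ^ σ) * φ u ≤ N := by
    refine (ae_restrict_iff' measurableSet_Ioi).1 ?_
    simpa [N, weightedNorm, eLpNorm_exponent_top] using
      enorm_ae_le_eLpNormEssSup (fun u => ENNReal.ofReal (u ^ σ) * φ u) (volume.restrict (Ioi 0))
  have hlim : Filter.Tendsto (fun u => ENNReal.ofReal (u ^ σ) * φ t) (nhdsWithin t (Iio t))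
      (nhds (ENNReal.ofReal (t ^ σ) * φ t)) :=
    ENNReal.Tendsto.mul_const (ENNReal.tendsto_ofReal
      ((Real.continuousAt_rpow_const t σ (.inl ht.ne')).tendsto.mono_left nhdsWithin_le_nhds))
      (.inl (by simpa using Real.rpow_pos_of_pos ht σ))
  refine le_of_tendsto_of_frequently hlim ((nhdsLT_basis t).frequently_iff.2 fun l hl => ?_)
  obtain ⟨u, hu, hlu, hut⟩ := (Measure.dense_of_ae hae).exists_between (max_lt hl ht)
  have hu0 : 0 < u := (le_max_right _ _).trans_lt hlu
  refine ⟨u, ⟨(le_max_left _ _).trans_lt hlu, hut⟩, le_trans ?_ (hu hu0)⟩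
  gcongr
  exact hφ hu0 ht hut.le

theorem lorentzSpace_top_qnorm (p : ℝ≥0∞) (f : Ω →ₘ[μ] 𝕜) :
    (lorentzSpace μ 𝕜 p ∞).qnorm f =
      ⨆ t ∈ Ioi (0 : ℝ), ENNReal.ofReal (t ^ (1 / p).toReal) * rearrangement f t := by
  refine le_antisymm ?_ (iSup₂_le fun t ht => ofReal_rpow_mul_le_weightedNorm_top
    ((antitone_rearrangement f).antitoneOn _) ht)
  refine essSup_le_of_ae_le _ (ae_restrict_of_forall_mem measurableSet_Ioi fun t ht => ?_)
  simpa using le_iSup₂ (f := fun t (_ : t ∈ Ioi (0 : ℝ)) =>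
    ENNReal.ofReal (t ^ (1 / p).toReal) * rearrangement f t) t ht

theorem lorentzSpace_top_qnorm_le_eLpNorm (hp : p ≠ 0) (f : Ω →ₘ[μ] 𝕜) :
    (lorentzSpace μ 𝕜 p ∞).qnorm f ≤ eLpNorm f p μ := by
  rw [lorentzSpace_top_qnorm]
  exact iSup₂_le fun t ht => ofReal_rpow_mul_rearrangement_le_eLpNorm hp f ht

end Rearrangement

section Peetre

variable {Ω : Type*} [MeasurableSpace Ω] {μ : Measure Ω} {𝕜 : Type*} [RCLike 𝕜] {p : ℝ≥0∞}

theorem peetreK_mono {A₀ A₀' A₁ : FunctionSpace μ 𝕜} (hc : A₀'.carrier ⊆ A₀.carrier)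
    (hN : ∀ f ∈ A₀'.carrier, A₀.qnorm f ≤ A₀'.qnorm f) (f : Ω →ₘ[μ] 𝕜) (t : ℝ) :
    peetreK A₀ A₁ f t ≤ peetreK A₀' A₁ f t := by
  refine le_sInf ?_
  rintro _ ⟨f₀, h₀, f₁, h₁, hf, rfl⟩
  exact le_trans (b := A₀.qnorm f₀ + ENNReal.ofReal t * A₁.qnorm f₁)
    (sInf_le ⟨f₀, hc h₀, f₁, h₁, hf, rfl⟩) (by gcongr; exact hN f₀ h₀)

theorem peetreK_eq_top {A₀ A₁ : FunctionSpace μ 𝕜} {f : Ω →ₘ[μ] 𝕜} (hf : f ∉ sumCarrier A₀ A₁) :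
    peetreK A₀ A₁ f = fun _ => ∞ := by
  funext t
  rw [peetreK, sInf_eq_top]
  rintro _ ⟨f₀, h₀, f₁, h₁, h, -⟩
  exact absurd ⟨f₀, h₀, f₁, h₁, h⟩ hf

theorem peetreK_lorentzSpace_le (hp : p ≠ 0) (A₁ : FunctionSpace μ 𝕜) (f : Ω →ₘ[μ] 𝕜) (t : ℝ) :
    peetreK (lorentzSpace μ 𝕜 p ∞) A₁ f t ≤ peetreK (lebesgueSpace μ 𝕜 p) A₁ f t :=
  peetreK_mono (fun f hf => (lorentzSpace_top_qnorm_le_eLpNorm hp f).trans_lt hf)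
    (fun f _ => lorentzSpace_top_qnorm_le_eLpNorm hp f) f t

theorem ofReal_mul_rearrangement_le_peetreK (hp : p ≠ 0) (hp' : p ≠ ∞) (f : Ω →ₘ[μ] 𝕜) {t : ℝ}
    (ht : 0 < t) : ENNReal.ofReal t * rearrangement f (t ^ p.toReal) ≤
      peetreK (lorentzSpace μ 𝕜 p ∞) (lebesgueSpace μ 𝕜 ∞) f t := by
  refine le_sInf ?_
  rintro _ ⟨f₀, -, f₁, -, rfl, rfl⟩
  have hroot : (t ^ p.toReal) ^ (1 / p).toReal = t := by
    rw [one_div, ENNReal.toReal_inv, Real.rpow_rpow_inv ht.le (ENNReal.toReal_pos hp hp').ne']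
  calc ENNReal.ofReal t * rearrangement (f₀ + f₁) (t ^ p.toReal)
      ≤ ENNReal.ofReal t * (rearrangement f₀ (t ^ p.toReal) + eLpNorm f₁ ∞ μ) := by
        gcongr
        exact rearrangement_add_le f₀ f₁ _
    _ = ENNReal.ofReal ((t ^ p.toReal) ^ (1 / p).toReal) * rearrangement f₀ (t ^ p.toReal) +
          ENNReal.ofReal t * eLpNorm f₁ ∞ μ := by rw [mul_add, hroot]
    _ ≤ (lorentzSpace μ 𝕜 p ∞).qnorm f₀ + ENNReal.ofReal t * eLpNorm f₁ ∞ μ := by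
        gcongr
        exact ofReal_rpow_mul_le_weightedNorm_top ((antitone_rearrangement f₀).antitoneOn _)
          (Real.rpow_pos_of_pos ht _)

theorem peetreK_lebesgueSpace_le (p₀ p₁ : ℝ≥0∞) {E : Set Ω} (hE : MeasurableSet E)
    (f : Ω →ₘ[μ] 𝕜) {t : ℝ} (ht : 0 < t) :
    peetreK (lebesgueSpace μ 𝕜 p₀) (lebesgueSpace μ 𝕜 p₁) f t ≤
      eLpNorm f p₀ (μ.restrict E) + ENNReal.ofReal t * eLpNorm f p₁ (μ.restrict Eᶜ) := by
  have hcut : ∀ {s : Set Ω}, MeasurableSet s → ∃ g : Ω →ₘ[μ] 𝕜, g =ᵐ[μ] s.indicator f ∧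
      ∀ p', eLpNorm g p' μ = eLpNorm f p' (μ.restrict s) := fun {s} hs => by
    have hg := AEEqFun.coeFn_mk (μ := μ) (s.indicator f)
      (f.stronglyMeasurable.indicator hs).aestronglyMeasurable
    exact ⟨_, hg, fun p' => by
      rw [eLpNorm_congr_ae hg, eLpNorm_indicator_eq_eLpNorm_restrict hs]⟩
  obtain ⟨f₀, hf₀, hnorm₀⟩ := hcut hE
  obtain ⟨f₁, hf₁, hnorm₁⟩ := hcut hE.compl
  have hf : f = f₀ + f₁ := by
    refine AEEqFun.ext ?_
    filter_upwards [AEEqFun.coeFn_add f₀ f₁, hf₀, hf₁] with x hadd h₀ h₁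
    rw [hadd, Pi.add_apply, h₀, h₁, ← Pi.add_apply, indicator_self_add_compl]
  rw [← hnorm₀, ← hnorm₁]
  rcases eq_or_ne (eLpNorm f₀ p₀ μ) ∞ with htop₀ | htop₀
  · simp [htop₀]
  rcases eq_or_ne (eLpNorm f₁ p₁ μ) ∞ with htop₁ | htop₁
  · simp [htop₁, ENNReal.mul_top, ht]
  exact sInf_le ⟨f₀, htop₀.lt_top, f₁, htop₁.lt_top, hf, rfl⟩

theorem subset_iInter_union_iUnion_diff {α : Type*} (E : ℕ → Set α) :
    E 0 ⊆ (⋂ k, E k) ∪ ⋃ k, E k \ E (k + 1) := by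
  intro x hx
  by_contra hcon
  simp only [mem_union, mem_iInter, mem_iUnion, Set.mem_sdiff, not_or, not_exists, not_and,
    not_not] at hcon
  exact hcon.1 fun k => Nat.rec hx hcon.2 k

theorem lintegral_rearrangement_lt_le {κ : ℝ} (hκ : 0 ≤ κ) (f : Ω →ₘ[μ] 𝕜) {s : ℕ → ℝ}
    (hs : Filter.Tendsto s Filter.atTop (nhds 0)) :
    ∫⁻ x in {x | rearrangement f (s 0) < ‖f x‖ₑ}, ‖f x‖ₑ ^ κ ∂μ ≤
      ∑' k, rearrangement f (s (k + 1)) ^ κ * ENNReal.ofReal (s k) := by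
  set E : ℕ → Set Ω := fun k => {x | rearrangement f (s k) < ‖f x‖ₑ}
  have hE : ∀ k, MeasurableSet (E k) := fun k =>
    measurableSet_lt measurable_const f.measurable.enorm
  have hnull : μ (⋂ k, E k) = 0 := by
    refine le_antisymm (ge_of_tendsto' (by simpa using ENNReal.tendsto_ofReal hs) fun k => ?_)
      zero_le
    exact (measure_mono (iInter_subset _ k)).trans (measure_rearrangement_lt_le f (s k))
  calc ∫⁻ x in E 0, ‖f x‖ₑ ^ κ ∂μ
      ≤ ∫⁻ x in (⋂ k, E k) ∪ ⋃ k, E k \ E (k + 1), ‖f x‖ₑ ^ κ ∂μ :=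
        lintegral_mono_set (subset_iInter_union_iUnion_diff E)
    _ ≤ ∫⁻ x in ⋃ k, E k \ E (k + 1), ‖f x‖ₑ ^ κ ∂μ := by
        refine (lintegral_union_le _ _ _).trans ?_
        rw [setLIntegral_measure_zero _ _ hnull, zero_add]
    _ ≤ ∑' k, ∫⁻ x in E k \ E (k + 1), ‖f x‖ₑ ^ κ ∂μ := lintegral_iUnion_le _ _
    _ ≤ ∑' k, ∫⁻ _ in E k \ E (k + 1), rearrangement f (s (k + 1)) ^ κ ∂μ := by
        refine ENNReal.tsum_le_tsum fun k =>
          setLIntegral_mono' ((hE k).diff (hE (k + 1))) fun x hx => ?_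
        exact ENNReal.rpow_le_rpow (not_lt.1 hx.2) hκ
    _ ≤ ∑' k, rearrangement f (s (k + 1)) ^ κ * ENNReal.ofReal (s k) := by
        gcongr with k
        rw [setLIntegral_const]
        gcongr
        exact (measure_mono sdiff_subset).trans (measure_rearrangement_lt_le f (s k))

theorem exists_tsum_rpow_mul_two_rpow_le {κ η : ℝ} (hκ : 0 < κ) (hη : η < 1) :
    ∃ C : ℝ≥0, ∀ g : ℕ → ℝ≥0∞, ∑' k, g (k + 1) ^ κ * 2 ^ (-(κ * k)) ≤
      (C * ⨆ k : ℕ, (2 : ℝ≥0∞) ^ (-(η * k)) * g k) ^ κ := by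
  set ρ : ℝ≥0∞ := 2 ^ (κ * (η - 1))
  have hρ : ρ < 1 := ENNReal.rpow_lt_one_of_one_lt_of_neg (by norm_num)
    (mul_neg_of_pos_of_neg hκ (by linarith))
  set D : ℝ≥0∞ := (∑' k : ℕ, ρ ^ k) ^ κ⁻¹
  have hD : D ≠ ∞ := ENNReal.rpow_ne_top_of_nonneg (by positivity) (tsum_pow_ne_top hρ)
  have htwo : ∀ x : ℝ, (2 : ℝ≥0∞) ^ x ≠ ∞ := fun x =>
    ENNReal.rpow_ne_top_of_ne_zero two_ne_zero ENNReal.ofNat_ne_top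
  refine ⟨(D * 2 ^ η).toNNReal, fun g => ?_⟩
  rw [ENNReal.coe_toNNReal (ENNReal.mul_ne_top hD (htwo η))]
  set M : ℝ≥0∞ := ⨆ k : ℕ, (2 : ℝ≥0∞) ^ (-(η * k)) * g k
  have hadd : ∀ x y : ℝ, (2 : ℝ≥0∞) ^ (x + y) = 2 ^ x * 2 ^ y := fun x y =>
    ENNReal.rpow_add x y two_ne_zero ENNReal.ofNat_ne_top
  have hg : ∀ k : ℕ, g k ≤ 2 ^ (η * k) * M := fun k => calc
    g k = 2 ^ (η * k) * (2 ^ (-(η * k)) * g k) := by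
      rw [← mul_assoc, ← hadd, add_neg_cancel, ENNReal.rpow_zero, one_mul]
    _ ≤ 2 ^ (η * k) * M := by
      gcongr
      exact le_iSup (fun k : ℕ => (2 : ℝ≥0∞) ^ (-(η * k)) * g k) k
  calc ∑' k : ℕ, g (k + 1) ^ κ * 2 ^ (-(κ * k))
      ≤ ∑' k : ℕ, (2 ^ (η * (k + 1 : ℕ)) * M) ^ κ * 2 ^ (-(κ * k)) := by
        gcongr with k
        exact hg (k + 1)
    _ = ∑' k : ℕ, ρ ^ k * (2 ^ η * M) ^ κ := by
        refine tsum_congr fun k => ?_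
        rw [ENNReal.mul_rpow_of_nonneg _ _ hκ.le, ENNReal.mul_rpow_of_nonneg _ _ hκ.le,
          mul_right_comm, ← mul_assoc, ← ENNReal.rpow_natCast, ← ENNReal.rpow_mul,
          ← ENNReal.rpow_mul, ← ENNReal.rpow_mul, ← hadd, ← hadd]
        congr 2
        push_cast
        ring
    _ = (D * 2 ^ η * M) ^ κ := by
        rw [ENNReal.tsum_mul_right, mul_assoc D, ENNReal.mul_rpow_of_nonneg D _ hκ.le,
          ENNReal.rpow_inv_rpow hκ.ne']

theorem exists_eLpNorm_restrict_rearrangement_lt_le (hp : p ≠ 0) (hp' : p ≠ ∞) {η : ℝ}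
    (hη : η < 1) :
    ∃ C : ℝ≥0, ∀ (f : Ω →ₘ[μ] 𝕜) (t : ℝ), 0 < t →
      eLpNorm f p (μ.restrict {x | rearrangement f (t ^ p.toReal) < ‖f x‖ₑ}) ≤
        C * (ENNReal.ofReal t *
          ⨆ k : ℕ, (2 : ℝ≥0∞) ^ (-(η * k)) * rearrangement f ((t / 2 ^ k) ^ p.toReal)) := by
  set κ : ℝ := p.toReal
  have hκ : 0 < κ := ENNReal.toReal_pos hp hp'
  obtain ⟨C, hC⟩ := exists_tsum_rpow_mul_two_rpow_le hκ hη
  refine ⟨C, fun f t ht => ?_⟩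
  set s : ℕ → ℝ := fun k => (t / 2 ^ k) ^ κ
  have hs0 : t ^ κ = s 0 := by simp only [s, pow_zero, div_one]
  have hs : Filter.Tendsto s Filter.atTop (nhds 0) := by
    have hdiv : Filter.Tendsto (fun k : ℕ => t / 2 ^ k) Filter.atTop (nhds 0) :=
      tendsto_const_nhds.div_atTop (tendsto_pow_atTop_atTop_of_one_lt one_lt_two)
    simpa only [Real.zero_rpow hκ.ne'] using hdiv.rpow_const (.inr hκ.le)
  have hs_eq : ∀ k, ENNReal.ofReal (s k) = ENNReal.ofReal t ^ κ * 2 ^ (-(κ * k)) := fun k => by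
    rw [← ENNReal.ofReal_rpow_of_nonneg (by positivity) hκ.le,
      ENNReal.ofReal_div_of_pos (by positivity), ENNReal.div_eq_inv_mul, mul_comm,
      ENNReal.mul_rpow_of_nonneg _ _ hκ.le, ENNReal.ofReal_pow zero_le_two, ENNReal.ofReal_ofNat,
      ← ENNReal.rpow_natCast, ← ENNReal.rpow_neg, ← ENNReal.rpow_mul, neg_mul, mul_comm κ]
  set M : ℝ≥0∞ := ⨆ k : ℕ, (2 : ℝ≥0∞) ^ (-(η * k)) * rearrangement f (s k)
  rw [hs0, eLpNorm_eq_lintegral_rpow_enorm_toReal hp hp', one_div, ENNReal.rpow_inv_le_iff hκ]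
  calc ∫⁻ x in {x | rearrangement f (s 0) < ‖f x‖ₑ}, ‖f x‖ₑ ^ κ ∂μ
      ≤ ∑' k, rearrangement f (s (k + 1)) ^ κ * ENNReal.ofReal (s k) :=
        lintegral_rearrangement_lt_le hκ.le f hs
    _ = ENNReal.ofReal t ^ κ * ∑' k : ℕ, rearrangement f (s (k + 1)) ^ κ * 2 ^ (-(κ * k)) := by
        simp only [hs_eq, mul_left_comm _ (ENNReal.ofReal t ^ κ), ENNReal.tsum_mul_left]
    _ ≤ ENNReal.ofReal t ^ κ * (C * M) ^ κ := by
        gcongr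
        exact hC fun k => rearrangement f (s k)
    _ = (C * (ENNReal.ofReal t * M)) ^ κ := by
        rw [← ENNReal.mul_rpow_of_nonneg _ _ hκ.le, mul_left_comm]

theorem exists_peetreK_lebesgueSpace_le (hp : p ≠ 0) (hp' : p ≠ ∞) {η : ℝ} (hη : η < 1) :
    ∃ C : ℝ≥0, ∀ (f : Ω →ₘ[μ] 𝕜) (t : ℝ), 0 < t →
      peetreK (lebesgueSpace μ 𝕜 p) (lebesgueSpace μ 𝕜 ∞) f t ≤
        C * (ENNReal.ofReal t *
          ⨆ k : ℕ, (2 : ℝ≥0∞) ^ (-(η * k)) * rearrangement f ((t / 2 ^ k) ^ p.toReal)) := by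
  obtain ⟨C, hlarge⟩ :=
    exists_eLpNorm_restrict_rearrangement_lt_le (μ := μ) (𝕜 := 𝕜) hp hp' hη
  refine ⟨C + 1, fun f t ht => ?_⟩
  set M : ℝ≥0∞ := ⨆ k : ℕ, (2 : ℝ≥0∞) ^ (-(η * k)) * rearrangement f ((t / 2 ^ k) ^ p.toReal)
  set E : Set Ω := {x | rearrangement f (t ^ p.toReal) < ‖f x‖ₑ}
  have hsmall : eLpNorm f ∞ (μ.restrict Eᶜ) ≤ M :=
    (eLpNorm_top_restrict_compl_rearrangement_lt_le f (t ^ p.toReal)).trans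
      (le_iSup_of_le 0 (by simp))
  calc peetreK (lebesgueSpace μ 𝕜 p) (lebesgueSpace μ 𝕜 ∞) f t
      ≤ eLpNorm f p (μ.restrict E) + ENNReal.ofReal t * eLpNorm f ∞ (μ.restrict Eᶜ) :=
        peetreK_lebesgueSpace_le p ∞ (measurableSet_lt measurable_const f.measurable.enorm) f ht
    _ ≤ C * (ENNReal.ofReal t * M) + ENNReal.ofReal t * M := by
        gcongr
        exact hlarge f t ht
    _ = (C + 1 : ℝ≥0) * (ENNReal.ofReal t * M) := by push_cast; ring

end Peetre

section Spaces

variable {Ω : Type*} [MeasurableSpace Ω] {μ : Measure Ω} {𝕜 : Type*} [RCLike 𝕜]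
  {θ α β κ : ℝ} {p q r : ℝ≥0∞} {a b : ℝ → ℝ}

theorem FunctionSpace.ofQNorm_embeds {N N' : (Ω →ₘ[μ] 𝕜) → ℝ≥0∞}
    (h : ∃ C : ℝ≥0, ∀ f, N' f ≤ C * N f) : (ofQNorm N).Embeds (ofQNorm N') := by
  obtain ⟨C, hC⟩ := h
  exact ⟨fun f hf => (hC f).trans_lt (ENNReal.mul_lt_top ENNReal.coe_lt_top hf), C,
    fun f _ => hC f⟩

theorem rInterpolationSpace_eq_ofQNorm (hr : r ≠ 0) (hb : ∀ t, 0 < t → 0 < b t) (hq : q ≠ 0)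
    (ha : ∀ t, 0 < t → 0 < a t) (A₀ A₁ : FunctionSpace μ 𝕜) (θ : ℝ) :
    rInterpolationSpace A₀ A₁ θ r b q a =
      .ofQNorm fun f => rNorm (-θ) r b q a (peetreK A₀ A₁ f) := by
  refine congrArg (FunctionSpace.mk · _) (Set.ext fun f => and_iff_right_of_imp fun hf => ?_)
  by_contra hsum
  rw [peetreK_eq_top hsum, rNorm_top hq hr ha hb] at hf
  exact hf.false

theorem rNorm_rearrangement_le_rNorm_peetreK (hp : p ≠ 0) (hp' : p ≠ ∞) (θ : ℝ) (r : ℝ≥0∞)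
    (b : ℝ → ℝ) (q : ℝ≥0∞) (a : ℝ → ℝ) (f : Ω →ₘ[μ] 𝕜) :
    rNorm (1 - θ) r b q a (fun t => rearrangement f (t ^ p.toReal)) ≤
      rNorm (-θ) r b q a (peetreK (lorentzSpace μ 𝕜 p ∞) (lebesgueSpace μ 𝕜 ∞) f) := by
  rw [sub_eq_neg_add, ← rNorm_ofReal_mul]
  exact rNorm_mono fun t ht => ofReal_mul_rearrangement_le_peetreK hp hp' f ht

theorem rNorm_peetreK_lorentzSpace_le (hp : p ≠ 0) (A₁ : FunctionSpace μ 𝕜) (σ : ℝ) (r : ℝ≥0∞)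
    (b : ℝ → ℝ) (q : ℝ≥0∞) (a : ℝ → ℝ) (f : Ω →ₘ[μ] 𝕜) :
    rNorm σ r b q a (peetreK (lorentzSpace μ 𝕜 p ∞) A₁ f) ≤
      rNorm σ r b q a (peetreK (lebesgueSpace μ 𝕜 p) A₁ f) :=
  rNorm_mono fun t _ => peetreK_lorentzSpace_le hp A₁ f t

theorem exists_rNorm_iSup_comp_div_le {σ η : ℝ} (hr : r ≠ 0) (hb : IsPowerBoundedWeight β b)
    (hq : q ≠ 0) (ha : IsPowerBoundedWeight α a) (hη : σ + α + β < η) :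
    ∃ C : ℝ≥0, ∀ φ : ℝ → ℝ≥0∞, Measurable φ →
      rNorm σ r b q a (fun t => ⨆ k : ℕ, (2 : ℝ≥0∞) ^ (-(η * k)) * φ (t / 2 ^ k)) ≤
        C * rNorm σ r b q a φ := by
  set ρ : ℝ≥0 := 2 ^ (η - (σ + α + β))
  obtain ⟨A, hA⟩ := exists_rNorm_iSup_le σ hr hb.aemeasurable hq ha.aemeasurable
    (NNReal.one_lt_rpow one_lt_two (sub_pos.2 hη) : 1 < ρ)
  obtain ⟨B, hB⟩ := exists_rNorm_comp_div_le σ hr hb hq ha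
  refine ⟨A * B, fun φ hφ => ?_⟩
  set ψ : ℕ → ℝ → ℝ≥0∞ := fun k t => (2 : ℝ≥0∞) ^ (-(η * k)) * φ (t / 2 ^ k)
  have hψ : ∀ k, (ρ : ℝ≥0∞) ^ k * rNorm σ r b q a (ψ k) ≤ B * rNorm σ r b q a φ := fun k => by
    have hcancel : ρ ^ k * (2 ^ (-(η * k)) * (2 ^ k) ^ (σ + α + β)) = 1 := by
      rw [← NNReal.rpow_natCast, ← NNReal.rpow_natCast, ← NNReal.rpow_mul, ← NNReal.rpow_mul,
        ← NNReal.rpow_add two_ne_zero, ← NNReal.rpow_add two_ne_zero]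
      ring_nf
      exact NNReal.rpow_zero 2
    calc (ρ : ℝ≥0∞) ^ k * rNorm σ r b q a (ψ k)
        ≤ ρ ^ k * ((2 ^ (-(η * k)) : ℝ≥0) * rNorm σ r b q a (fun t => φ (t / (2 ^ k : ℝ≥0)))) := by
          gcongr
          refine rNorm_le_mul fun t _ => ?_
          rw [ENNReal.coe_rpow_of_ne_zero two_ne_zero]
          simp [ψ]
      _ ≤ ρ ^ k * ((2 ^ (-(η * k)) : ℝ≥0) *
            (B * ((2 ^ k : ℝ≥0) : ℝ≥0∞) ^ (σ + α + β) * rNorm σ r b q a φ)) := by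
          gcongr
          exact hB φ _ (one_le_pow₀ one_le_two)
      _ = (ρ ^ k * (2 ^ (-(η * k)) * (2 ^ k) ^ (σ + α + β)) : ℝ≥0) *
            (B * rNorm σ r b q a φ) := by
          rw [← ENNReal.coe_rpow_of_ne_zero (by positivity)]
          push_cast
          ring
      _ = B * rNorm σ r b q a φ := by rw [hcancel, ENNReal.coe_one, one_mul]
  calc rNorm σ r b q a (fun t => ⨆ k, ψ k t)
      ≤ A * ⨆ k, (ρ : ℝ≥0∞) ^ k * rNorm σ r b q a (ψ k) :=
        hA ψ fun k => by fun_prop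
    _ ≤ A * (B * rNorm σ r b q a φ) := by
        gcongr
        exact iSup_le hψ
    _ = (A * B : ℝ≥0) * rNorm σ r b q a φ := by rw [ENNReal.coe_mul, mul_assoc]

theorem exists_rNorm_peetreK_lebesgueSpace_le (hp : p ≠ 0) (hp' : p ≠ ∞) (hr : r ≠ 0)
    (hb : IsPowerBoundedWeight β b) (hq : q ≠ 0) (ha : IsPowerBoundedWeight α a)
    (hαβ : α + β < θ) :
    ∃ C : ℝ≥0, ∀ f : Ω →ₘ[μ] 𝕜,
      rNorm (-θ) r b q a (peetreK (lebesgueSpace μ 𝕜 p) (lebesgueSpace μ 𝕜 ∞) f) ≤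
        C * rNorm (1 - θ) r b q a (fun t => rearrangement f (t ^ p.toReal)) := by
  obtain ⟨η, hη, hη1⟩ := exists_between (by linarith : 1 - θ + α + β < 1)
  obtain ⟨A, hA⟩ := exists_peetreK_lebesgueSpace_le (μ := μ) (𝕜 := 𝕜) hp hp' hη1
  obtain ⟨B, hB⟩ := exists_rNorm_iSup_comp_div_le hr hb hq ha hη
  refine ⟨A * B, fun f => ?_⟩
  set φ : ℝ → ℝ≥0∞ := fun t => rearrangement f (t ^ p.toReal)
  have hφ : Measurable φ := (antitone_rearrangement f).measurable.comp (by fun_prop)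
  calc rNorm (-θ) r b q a (peetreK (lebesgueSpace μ 𝕜 p) (lebesgueSpace μ 𝕜 ∞) f)
      ≤ A * rNorm (-θ) r b q a (fun t =>
          ENNReal.ofReal t * ⨆ k : ℕ, (2 : ℝ≥0∞) ^ (-(η * k)) * φ (t / 2 ^ k)) :=
        rNorm_le_mul (hA f)
    _ = A * rNorm (1 - θ) r b q a (fun t =>
          ⨆ k : ℕ, (2 : ℝ≥0∞) ^ (-(η * k)) * φ (t / 2 ^ k)) := by
        rw [rNorm_ofReal_mul, neg_add_eq_sub]
    _ ≤ A * (B * rNorm (1 - θ) r b q a φ) := by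
        gcongr
        exact hB φ hφ
    _ = (A * B : ℝ≥0) * rNorm (1 - θ) r b q a φ := by rw [ENNReal.coe_mul, mul_assoc]

theorem rLorentzKaramataSpace_one (p r : ℝ≥0∞) (b : ℝ → ℝ) (q : ℝ≥0∞) :
    rLorentzKaramataSpace μ 𝕜 p r b q (fun _ => 1) = grandLorentzKaramataSpace μ 𝕜 p q r b := by
  simp only [rLorentzKaramataSpace, grandLorentzKaramataSpace, rNorm, weightedNorm, zero_sub,
    mul_one]

theorem theorem5p4_general (μ : Measure Ω) (𝕜 : Type*) [RCLike 𝕜] (hθ : θ ≤ 1) (hκ : 0 < κ)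
    (hp : p = ENNReal.ofReal κ / ENNReal.ofReal (1 - θ)) (hq : 0 < q) (hr : 0 < r)
    (ha : IsPowerBoundedWeight α a) (hb : IsPowerBoundedWeight β b) (hαβ : α + β < θ) :
    (rInterpolationSpace (lebesgueSpace μ 𝕜 (ENNReal.ofReal κ)) (lebesgueSpace μ 𝕜 ∞)
          θ r b q a).Equal
        (rInterpolationSpace (lorentzSpace μ 𝕜 (ENNReal.ofReal κ) ∞) (lebesgueSpace μ 𝕜 ∞)
          θ r b q a) ∧
      (rInterpolationSpace (lorentzSpace μ 𝕜 (ENNReal.ofReal κ) ∞) (lebesgueSpace μ 𝕜 ∞)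
          θ r b q a).Equal
        (rLorentzKaramataSpace μ 𝕜 p r (fun t => b (t ^ (1 / κ))) q
          (fun t => a (t ^ (1 / κ)))) := by
  have hp_inv : (1 / p).toReal = (1 - θ) / κ := by
    rw [hp, one_div, ENNReal.inv_div (.inl ENNReal.ofReal_ne_top) (.inr (by simpa using hκ)),
      ENNReal.toReal_div, ENNReal.toReal_ofReal hκ.le, ENNReal.toReal_ofReal (sub_nonneg.2 hθ)]
  have hκ0 : ENNReal.ofReal κ ≠ 0 := by simpa using hκ
  have hκ' : ENNReal.ofReal κ ≠ ∞ := ENNReal.ofReal_ne_top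
  obtain ⟨c, hc0, hc, hscale⟩ := exists_rNorm_comp_rpow_eq (1 - θ) hr.ne' b hq.ne' a hκ
  obtain ⟨C, hC⟩ := exists_rNorm_peetreK_lebesgueSpace_le (μ := μ) (𝕜 := 𝕜) hκ0 hκ' hr.ne' hb
    hq.ne' ha hαβ
  have hlower := rNorm_rearrangement_le_rNorm_peetreK (μ := μ) (𝕜 := 𝕜) hκ0 hκ' θ r b q a
  have hweak := rNorm_peetreK_lorentzSpace_le hκ0 (lebesgueSpace μ 𝕜 ∞) (-θ) r b q a
  lift c to ℝ≥0 using hc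
  simp only [ENNReal.toReal_ofReal hκ.le, hscale, ← hp_inv] at hC hlower
  rw [rInterpolationSpace_eq_ofQNorm hr.ne' hb.pos hq.ne' ha.pos,
    rInterpolationSpace_eq_ofQNorm hr.ne' hb.pos hq.ne' ha.pos]
  refine ⟨⟨?_, ?_⟩, ?_, ?_⟩ <;> refine FunctionSpace.ofQNorm_embeds ?_
  · exact ⟨1, fun f => by simpa using hweak f⟩
  · refine ⟨C, fun f => (hC f).trans ?_⟩
    gcongr
    exact hlower f
  · refine ⟨c⁻¹, fun f => ?_⟩
    rw [ENNReal.coe_inv (mod_cast hc0), ← ENNReal.mul_le_iff_le_inv hc0 ENNReal.coe_ne_top]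
    exact hlower f
  · refine ⟨C * c, fun f => (hweak f).trans ?_⟩
    rw [ENNReal.coe_mul, mul_assoc]
    exact hC f

end Spaces

/-- Here `b(t^{1/κ})` and `a(t^{1/κ})` are the weights of the Lorentz-Karamata spaces, and
`p = κ / (1 - θ)` is computed in `[0, ∞]`, so that `p = ∞` if `θ = 1`. -/
theorem theorem5p4 {Ω : Type*} [MeasurableSpace Ω] (μ : Measure Ω) [SigmaFinite μ]
    (hμ : IsNonatomicMeasure μ) (𝕜 : Type*) [RCLike 𝕜]
    (θ : ℝ) (hθ0 : 0 < θ) (hθ1 : θ ≤ 1) (κ : ℝ) (hκ : 0 < κ)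
    (p : ℝ≥0∞) (hp : p = ENNReal.ofReal κ / ENNReal.ofReal (1 - θ))
    (q r : ℝ≥0∞) (hq : 0 < q) (hr : 0 < r)
    (a b : ℝ → ℝ) (ha : IsSlowlyVarying a) (hb : IsSlowlyVarying b) :
    ((rInterpolationSpace (lebesgueSpace μ 𝕜 (ENNReal.ofReal κ)) (lebesgueSpace μ 𝕜 ∞)
          θ r b q a).Equal
        (rInterpolationSpace (lorentzSpace μ 𝕜 (ENNReal.ofReal κ) ∞) (lebesgueSpace μ 𝕜 ∞)
          θ r b q a) ∧
      (rInterpolationSpace (lorentzSpace μ 𝕜 (ENNReal.ofReal κ) ∞) (lebesgueSpace μ 𝕜 ∞)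
          θ r b q a).Equal
        (rLorentzKaramataSpace μ 𝕜 p r (fun t => b (t ^ (1 / κ))) q
          (fun t => a (t ^ (1 / κ))))) ∧
    ((rInterpolationSpace (lebesgueSpace μ 𝕜 (ENNReal.ofReal κ)) (lebesgueSpace μ 𝕜 ∞)
          θ r b q (fun _ => 1)).Equal
        (rInterpolationSpace (lorentzSpace μ 𝕜 (ENNReal.ofReal κ) ∞) (lebesgueSpace μ 𝕜 ∞)
          θ r b q (fun _ => 1)) ∧
      (rInterpolationSpace (lorentzSpace μ 𝕜 (ENNReal.ofReal κ) ∞) (lebesgueSpace μ 𝕜 ∞)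
          θ r b q (fun _ => 1)).Equal
        (grandLorentzKaramataSpace μ 𝕜 p q r (fun t => b (t ^ (1 / κ))))) := by
  have ha' := ha.isPowerBoundedWeight (ε := θ / 3) (by positivity)
  have hb' := hb.isPowerBoundedWeight (ε := θ / 3) (by positivity)
  refine ⟨theorem5p4_general μ 𝕜 hθ1 hκ hp hq hr ha' hb' (by linarith), ?_⟩
  simpa only [rLorentzKaramataSpace_one] using
    theorem5p4_general μ 𝕜 hθ1 hκ hp hq hr .one hb' (by linarith)
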